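/- Let $\mathcal{M}=\{c\in\mathbb{C}: \text{the orbit of } 0 \text{ under } t\mapsto t^2+c \text{ is bounded}\}$ be the Mandelbrot set. A hyperbolic component of $\mathcal{M}$ is a connected component of the set of those $c\in\mathcal{M}$ for which $t\mapsto t^2+c$ has an attracting cycle in $\mathbb{C}$, that is, a periodic orbit whose multiplier has modulus less than $1$. For $\lambda\in\mathbb{C}\setminus\{0\}$ let $P(x)=\lambda x(1-x)$, which is affinely conjugate to $t\mapsto t^2+c$ with $c=\lambda/2-\lambda^2/4$. Let $J$ be the Julia set of $P$, i.e. the complement of the set of points of $\mathbb{C}$ that have a neighbourhood on which the iterates of $P$ form a normal family in the sense of Montel (limit $\infty$ allowed). If $c=\lambda/2-\lambda^2/4$ lies in a hyperbolic component of $\mathcal{M}$, then there is $\delta>0$ (depending on $\lambda$) such that $|P'(\tau)|>\delta$ for all $\tau\in J$. In particular, the critical point of $P$ does not lie on $J$. -/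

import Mathlib

open Filter Topology

noncomputable section

/-- The monic centred quadratic map `t ↦ t ^ 2 + c`. -/
def quadMap (c : ℂ) : ℂ → ℂ := fun t => t ^ 2 + c

/-- The quadratic map `x ↦ lam * x * (1 - x)`. -/
def logisticMap (lam : ℂ) : ℂ → ℂ := fun x => lam * x * (1 - x)

/-- The parameter `c` for which `t ↦ t ^ 2 + c` is affinely conjugate to `logisticMap lam`. -/
def logisticParam (lam : ℂ) : ℂ := lam / 2 - lam ^ 2 / 4

/-- The Mandelbrot set: the `c` for which the orbit of `0` under `t ↦ t ^ 2 + c` is bounded. -/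
def mandelbrotSet : Set ℂ :=
  {c | Bornology.IsBounded (Set.range fun n : ℕ => (quadMap c)^[n] 0)}

/-- `f` has an attracting cycle in the plane: a periodic point whose multiplier has modulus less
than one (superattracting cycles are allowed). -/
def HasAttractingCycle (f : ℂ → ℂ) : Prop :=
  ∃ (z : ℂ) (n : ℕ), 0 < n ∧ Function.IsPeriodicPt f n z ∧ ‖deriv (f^[n]) z‖ < 1

/-- The parameters in the Mandelbrot set whose quadratic map has an attracting cycle. -/
def hyperbolicParameters : Set ℂ :=
  {c | c ∈ mandelbrotSet ∧ HasAttractingCycle (quadMap c)}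

/-- A hyperbolic component of the Mandelbrot set: a connected component of the set of parameters
that have an attracting cycle. -/
def IsHyperbolicComponent (H : Set ℂ) : Prop :=
  ∃ c ∈ hyperbolicParameters, H = connectedComponentIn hyperbolicParameters c

/-- Normality on `U` in the sense of Montel, for a family of entire functions: every sequence in
the family has a subsequence that, uniformly on compact subsets of `U`, converges to a finite
function or diverges to infinity. -/
def IsNormalFamilyOn (F : Set (ℂ → ℂ)) (U : Set ℂ) : Prop :=
  ∀ g : ℕ → ℂ → ℂ, (∀ k, g k ∈ F) → ∃ s : ℕ → ℕ, StrictMono s ∧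
    ((∃ h : ℂ → ℂ, TendstoLocallyUniformlyOn (fun k => g (s k)) h atTop U) ∨
      ∀ K ⊆ U, IsCompact K → ∀ R : ℝ, ∀ᶠ k in atTop, ∀ z ∈ K, R < ‖g (s k) z‖)

/-- The Fatou set: the points with a neighbourhood on which the iterates form a normal family. -/
def fatouSet (f : ℂ → ℂ) : Set ℂ :=
  {z | ∃ U : Set ℂ, IsOpen U ∧ z ∈ U ∧ IsNormalFamilyOn (Set.range fun n : ℕ => f^[n]) U}

/-- The Julia set: the complement of the Fatou set. -/
def juliaSet (f : ℂ → ℂ) : Set ℂ := (fatouSet f)ᶜ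

end

open Metric

/-! By Fatou's theorem, an attracting cycle attracts the critical orbit
(`exists_iterate_quadMap_mem_ball`). Otherwise all inverse branches along the cycle would exist on
one fixed disc, uniformly bounded by an escape radius; Cauchy's estimate bounds their derivatives,
which contradicts a multiplier of modulus less than 1. Points attracted to the cycle are Fatou
(`exists_forall_mem_fatouSet`), so the critical point 1/2 has a Fatou neighbourhood, and `P'(τ) =
2λ(1/2 - τ)` stays away from 0 on the Julia set. -/

/-! ### Inverse branches and the critical orbit -/

/-- A zero-free holomorphic function on a disc has a holomorphic square root there, with either of
the two possible values at the centre. -/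
theorem exists_differentiableOn_sq_eq_of_ball {g : ℂ → ℂ} {z w : ℂ} {r : ℝ} (hr : 0 < r)
    (hg : DifferentiableOn ℂ g (ball z r)) (hg0 : ∀ x ∈ ball z r, g x ≠ 0) (hw : w ^ 2 = g z) :
    ∃ h : ℂ → ℂ, DifferentiableOn ℂ h (ball z r) ∧ h z = w ∧ ∀ x ∈ ball z r, h x ^ 2 = g x := by
  have hz : z ∈ ball z r := mem_ball_self hr
  -- The root is `w * exp L`, with `L` the primitive of `g' / (2g)` vanishing at the centre.
  have hd : DifferentiableOn ℂ (fun x => deriv g x / (2 * g x)) (ball z r) :=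
    (hg.deriv isOpen_ball).div (hg.const_mul 2) fun x hx => mul_ne_zero two_ne_zero (hg0 x hx)
  obtain ⟨L, hLz, hL⟩ := hd.isExactOn_ball.with_val_at z 0
  have hk : ∀ x ∈ ball z r, HasDerivAt (fun x => g x * Complex.exp (-2 * L x)) 0 x := by
    intro x hx
    have hgx : HasDerivAt g (deriv g x) x :=
      (hg.differentiableAt (isOpen_ball.mem_nhds hx)).hasDerivAt
    refine (hgx.mul (((hL x hx).const_mul (-2)).cexp)).congr_deriv ?_
    have := hg0 x hx
    field_simp
    ring
  have hconst : ∀ x ∈ ball z r, g x * Complex.exp (-2 * L x) = g z := by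
    intro x hx
    have := isOpen_ball.is_const_of_deriv_eq_zero (convex_ball z r).isPreconnected
      (fun x hx => (hk x hx).differentiableAt.differentiableWithinAt)
      (fun x hx => (hk x hx).deriv) hx hz
    simpa [hLz] using this
  refine ⟨fun x => w * Complex.exp (L x), fun x hx =>
    ((hL x hx).cexp.const_mul w).differentiableAt.differentiableWithinAt, by simp [hLz], ?_⟩
  intro x hx
  have h2 : Complex.exp (-2 * L x) * Complex.exp (L x) ^ 2 = 1 := by
    rw [← Complex.exp_nat_mul, ← Complex.exp_add]
    simp
  rw [mul_pow, hw, ← hconst x hx, mul_assoc, h2, mul_one]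

theorem norm_le_norm_quadMap {c t : ℂ} (ht : ‖c‖ + 2 < ‖t‖) : ‖t‖ ≤ ‖quadMap c t‖ := by
  have h1 : ‖t‖ ^ 2 ≤ ‖t ^ 2 + c‖ + ‖c‖ := by
    have h2 := norm_sub_le (t ^ 2 + c) c
    rwa [add_sub_cancel_right, norm_pow] at h2
  have h0 := norm_nonneg c
  unfold quadMap
  nlinarith

/-- Read contrapositively, this bounds preimages of a bounded set under all iterates at once, hence
the inverse branches uniformly. -/
theorem norm_le_norm_iterate_quadMap {c t : ℂ} (ht : ‖c‖ + 2 < ‖t‖) (k : ℕ) :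
    ‖t‖ ≤ ‖(quadMap c)^[k] t‖ := by
  induction k with
  | zero => rfl
  | succ k ih =>
    rw [Function.iterate_succ_apply']
    exact ih.trans (norm_le_norm_quadMap (ht.trans_le ih))

theorem differentiable_quadMap (c : ℂ) : Differentiable ℂ (quadMap c) := by
  unfold quadMap; fun_prop

theorem differentiable_logisticMap (lam : ℂ) : Differentiable ℂ (logisticMap lam) := by
  unfold logisticMap; fun_prop

theorem Differentiable.iterate_complex {f : ℂ → ℂ} (hf : Differentiable ℂ f) (k : ℕ) :
    Differentiable ℂ f^[k] := by
  induction k with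
  | zero => exact differentiable_id
  | succ k ih => rw [Function.iterate_succ]; exact ih.comp hf

/-- Inverse branches of the iterates of a quadratic map along a backward orbit, on a disc that the
forward orbit of the critical value avoids. -/
theorem exists_inverse_branch_quadMap {c : ℂ} {p : ℕ → ℂ} {r : ℝ} (hr : 0 < r)
    (hp : ∀ k, quadMap c (p (k + 1)) = p k)
    (hc : ∀ k, (quadMap c)^[k] c ∉ ball (p 0) r) (k : ℕ) :
    ∃ φ : ℂ → ℂ, DifferentiableOn ℂ φ (ball (p 0) r) ∧ φ (p 0) = p k ∧
      ∀ x ∈ ball (p 0) r, (quadMap c)^[k] (φ x) = x := by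
  induction k with
  | zero => exact ⟨id, differentiableOn_id, rfl, fun _ _ => rfl⟩
  | succ k ih =>
    obtain ⟨φ, hφ, hφ0, hinv⟩ := ih
    -- The next branch is a square root of `φ - c`, which has no zero: `φ x = c` would give `f^k(c)
    -- = x` in the disc.
    obtain ⟨ψ, hψ, hψ0, hsq⟩ := exists_differentiableOn_sq_eq_of_ball (g := fun x => φ x - c)
      (w := p (k + 1)) hr (hφ.sub_const c)
      (fun x hx h0 => hc k (by
        have := hinv x hx
        rw [sub_eq_zero.1 h0] at this
        rwa [this]))
      (by rw [hφ0, ← hp k]; simp [quadMap])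
    refine ⟨ψ, hψ, hψ0, fun x hx => ?_⟩
    rw [Function.iterate_succ_apply, show quadMap c (ψ x) = φ x by simp [quadMap, hsq x hx]]
    exact hinv x hx

/-- The critical orbit of a quadratic map accumulates at every attracting periodic point. -/
theorem exists_iterate_quadMap_mem_ball {c z : ℂ} {n : ℕ} (hn : 0 < n)
    (hz : Function.IsPeriodicPt (quadMap c) n z) (hd : ‖deriv ((quadMap c)^[n]) z‖ < 1)
    {r : ℝ} (hr : 0 < r) : ∃ k, (quadMap c)^[k] 0 ∈ ball z r := by
  by_contra! hcon
  wlog hr1 : r ≤ 1 generalizing r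
  · exact this one_pos
      (fun k hk => hcon k (ball_subset_ball (not_le.1 hr1).le hk)) le_rfl
  set f := quadMap c with hf
  -- On the cycle `f^[n - 1]` inverts `f`, so this is the backward orbit inside the cycle.
  set p : ℕ → ℂ := fun k => f^[(n - 1) * k] z with hpdef
  have hp0 : p 0 = z := by simp [p]
  have hp : ∀ k, f (p (k + 1)) = p k := by
    intro k
    have e : (n - 1) * (k + 1) + 1 = (n - 1) * k + n := by
      rw [Nat.mul_add, Nat.mul_one, Nat.add_assoc, Nat.sub_add_cancel hn]
    simp only [p]
    rw [← Function.iterate_succ_apply' f, Nat.succ_eq_add_one, e, Function.iterate_add_apply,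
      hz.eq]
  have hpn : ∀ j, p (n * j) = z := by
    intro j
    exact (hz.mul_const ((n - 1) * j)).eq ▸ by
      simp only [p]
      rw [Nat.mul_left_comm]
  have hc : ∀ k, f^[k] c ∉ ball (p 0) r := by
    intro k hk
    refine hcon (k + 1) ?_
    rw [Function.iterate_succ_apply, show f 0 = c by simp [f, quadMap], ← hp0]
    exact hk
  -- The chain rule makes multiplier^j times `φ'(z)` equal to 1, while Cauchy bounds `φ'(z)`
  -- independently of `j`.
  have key : ∀ j : ℕ, 1 ≤ ‖deriv (f^[n]) z‖ ^ j * ((‖c‖ + 2 + ‖z‖ + 1) / (r / 2)) := by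
    intro j
    obtain ⟨φ, hφ, hφ0, hinv⟩ := exists_inverse_branch_quadMap hr hp hc (n * j)
    rw [hp0] at hφ hφ0 hinv
    rw [hpn] at hφ0
    have hbd : ∀ x ∈ ball z r, ‖φ x‖ ≤ ‖c‖ + 2 + ‖z‖ + 1 := by
      intro x hx
      by_contra! hlt
      have h0 := norm_nonneg z
      have h1 := norm_le_norm_iterate_quadMap (c := c) (t := φ x) (by linarith) (n * j)
      rw [hinv x hx] at h1
      have h2 : ‖x‖ ≤ ‖x - z‖ + ‖z‖ := by simpa using norm_add_le (x - z) z
      rw [mem_ball, dist_eq_norm] at hx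
      have h3 := norm_nonneg c
      linarith
    have hcb : closedBall z (r / 2) ⊆ ball z r := closedBall_subset_ball (by linarith)
    have hcauchy : ‖deriv φ z‖ ≤ (‖c‖ + 2 + ‖z‖ + 1) / (r / 2) :=
      Complex.norm_deriv_le_of_forall_mem_sphere_norm_le (by linarith)
        ((hφ.mono hcb).diffContOnCl_ball subset_rfl)
        fun x hx => hbd x (hcb (sphere_subset_closedBall hx))
    have hball : ball z r ∈ 𝓝 z := ball_mem_nhds z hr
    have hφd : HasDerivAt φ (deriv φ z) z := (hφ.differentiableAt hball).hasDerivAt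
    have hfd : HasDerivAt (f^[n * j]) (deriv (f^[n]) z ^ j) (φ z) := by
      rw [hφ0, Function.iterate_mul]
      exact HasDerivAt.iterate z ((differentiable_quadMap c).iterate_complex n z).hasDerivAt hz.eq j
    have hone : deriv (f^[n]) z ^ j * deriv φ z = 1 :=
      (hfd.comp z hφd).unique ((hasDerivAt_id z).congr_of_eventuallyEq
        (Filter.eventually_of_mem hball hinv))
    calc (1 : ℝ) = ‖deriv (f^[n]) z‖ ^ j * ‖deriv φ z‖ := by
          rw [← norm_pow, ← norm_mul, hone, norm_one]
      _ ≤ _ := by gcongr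
  have ht : Tendsto (fun j : ℕ => ‖deriv (f^[n]) z‖ ^ j * ((‖c‖ + 2 + ‖z‖ + 1) / (r / 2))) atTop
      (𝓝 (0 * ((‖c‖ + 2 + ‖z‖ + 1) / (r / 2)))) :=
    (tendsto_pow_atTop_nhds_zero_of_lt_one (norm_nonneg _) hd).mul_const _
  rw [zero_mul] at ht
  exact absurd (ge_of_tendsto' ht key) (by norm_num)

/-! ### Attraction implies normality -/

theorem tendsto_atTop_of_frequently_ne {m : ℕ → ℕ} (h : ¬∃ v, ∃ᶠ k in atTop, m k = v) :
    Tendsto m atTop atTop := by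
  rw [Filter.tendsto_atTop]
  intro b
  simp only [not_exists, not_frequently] at h
  filter_upwards [(Set.finite_Iio b).eventually_all.2 fun v _ => h v] with k hk
  by_contra! hlt
  exact hk (m k) hlt rfl

/-- Points whose orbit comes close to an attracting periodic point lie in the Fatou set. -/
theorem exists_forall_mem_fatouSet {f : ℂ → ℂ} (hf : Differentiable ℂ f) {z : ℂ} {n : ℕ}
    (hn : 0 < n) (hz : Function.IsPeriodicPt f n z) (hd : ‖deriv (f^[n]) z‖ < 1) :
    ∃ r > 0, ∀ x k, f^[k] x ∈ ball z r → x ∈ fatouSet f := by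
  obtain ⟨q, hq, hq1⟩ := exists_between hd
  have hq0 : 0 ≤ q := (norm_nonneg _).trans hq.le
  have hg : HasDerivAt (f^[n]) (deriv (f^[n]) z) z := (hf.iterate_complex n z).hasDerivAt
  obtain ⟨r, hr, hball⟩ := Metric.eventually_nhds_iff_ball.1
    ((hasDerivAt_iff_isLittleO.1 hg).def (sub_pos.2 hq))
  have hcontr : ∀ y ∈ ball z r, ‖f^[n] y - z‖ ≤ q * ‖y - z‖ := by
    intro y hy
    have h1 := hball y hy
    rw [hz.eq] at h1
    have h2 := norm_add_le (f^[n] y - z - (y - z) • deriv (f^[n]) z)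
      ((y - z) • deriv (f^[n]) z)
    rw [sub_add_cancel, norm_smul] at h2
    nlinarith
  have hiter : ∀ j, ∀ y ∈ ball z r, ‖(f^[n])^[j] y - z‖ ≤ q ^ j * r := by
    intro j
    induction j with
    | zero => intro y hy; simpa [dist_eq_norm] using (mem_ball.1 hy).le
    | succ j ih =>
      intro y hy
      have hj := ih y hy
      have hy' : ‖y - z‖ < r := by simpa [dist_eq_norm] using hy
      -- The bound `ih` is not strict, so it does not place the iterate in the open ball when `j =
      -- 0`.
      have hmem : (f^[n])^[j] y ∈ ball z r := by
        clear hj ih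
        induction j with
        | zero => exact hy
        | succ j ihj =>
          rw [Function.iterate_succ_apply', mem_ball, dist_eq_norm]
          rw [mem_ball, dist_eq_norm] at ihj
          refine (hcontr _ (by rwa [mem_ball, dist_eq_norm])).trans_lt ?_
          nlinarith [norm_nonneg ((f^[n])^[j] y - z)]
      rw [Function.iterate_succ_apply', pow_succ']
      calc _ ≤ q * ‖(f^[n])^[j] y - z‖ := hcontr _ hmem
        _ ≤ q * (q ^ j * r) := by gcongr
        _ = _ := by ring
  refine ⟨r, hr, fun x N hx => ⟨f^[N] ⁻¹' ball z r,
    isOpen_ball.preimage (hf.iterate_complex N).continuous, hx, fun g hgF => ?_⟩⟩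
  choose m hm using hgF
  -- Either one iterate recurs infinitely often, or the exponents tend to infinity; then fixing a
  -- residue mod `n` gives convergence to a point of the cycle.
  by_cases hfreq : ∃ v, ∃ᶠ k in atTop, m k = v
  · obtain ⟨v, hv⟩ := hfreq
    obtain ⟨s, hs, hsv⟩ := extraction_of_frequently_atTop hv
    refine ⟨s, hs, Or.inl ⟨f^[v], TendstoUniformlyOn.tendstoLocallyUniformlyOn ?_⟩⟩
    rw [Metric.tendstoUniformlyOn_iff]
    intro ε hε
    refine Eventually.of_forall fun k y _ => ?_
    rw [← hm, hsv]
    simpa using hε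
  · have hmt := tendsto_atTop_of_frequently_ne hfreq
    have hres : ∃ i : Fin n, ∃ᶠ k in atTop, (m k - N) % n = i :=
      Filter.frequently_exists.1 (Eventually.frequently (Eventually.of_forall fun k =>
        ⟨⟨(m k - N) % n, Nat.mod_lt _ hn⟩, rfl⟩))
    obtain ⟨i, hi⟩ := hres
    obtain ⟨s, hs, hsi⟩ := extraction_of_frequently_atTop hi
    refine ⟨s, hs, Or.inl ⟨fun _ => f^[i] z, TendstoUniformlyOn.tendstoLocallyUniformlyOn ?_⟩⟩
    rw [Metric.tendstoUniformlyOn_iff]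
    intro ε hε
    obtain ⟨δ, hδ, hδε⟩ := Metric.continuousAt_iff.1
      (hf.iterate_complex i).continuous.continuousAt ε hε
    have hms : Tendsto (fun k => m (s k)) atTop atTop := hmt.comp hs.tendsto_atTop
    have hj : Tendsto (fun k => (m (s k) - N) / n) atTop atTop :=
      (Nat.tendsto_div_const_atTop hn.ne').comp ((tendsto_sub_atTop_nat N).comp hms)
    have hqr : Tendsto (fun k => q ^ ((m (s k) - N) / n) * r) atTop (𝓝 0) := by
      simpa using ((tendsto_pow_atTop_nhds_zero_of_lt_one hq0 hq1).comp hj).mul_const r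
    filter_upwards [hms.eventually_ge_atTop N, hqr.eventually_lt_const hδ] with k hk hkδ y hy
    have hsplit : g (s k) y = f^[i] ((f^[n])^[(m (s k) - N) / n] (f^[N] y)) := by
      rw [← hm, ← Function.iterate_mul, ← Function.iterate_add_apply,
        ← Function.iterate_add_apply, ← hsi k, Nat.mod_add_div, Nat.sub_add_cancel hk]
    rw [hsplit, dist_comm]
    exact hδε (by rw [dist_eq_norm]; exact (hiter _ _ hy).trans_lt hkδ)

/-! ### Transfer to the logistic map -/

theorem semiconj_logisticMap_quadMap (lam : ℂ) :
    Function.Semiconj (fun x => lam / 2 - lam * x) (logisticMap lam)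
      (quadMap (logisticParam lam)) := by
  intro x
  simp only [logisticMap, quadMap, logisticParam]
  ring

/-- If the quadratic map conjugate to a logistic map has an attracting cycle, then the critical
point of the logistic map is in the Fatou set. -/
theorem half_mem_fatouSet_logisticMap {lam : ℂ} (hlam : lam ≠ 0)
    (h : HasAttractingCycle (quadMap (logisticParam lam))) :
    (1 / 2 : ℂ) ∈ fatouSet (logisticMap lam) := by
  obtain ⟨z, n, hn, hz, hd⟩ := h
  set A : ℂ → ℂ := fun x => lam / 2 - lam * x
  set B : ℂ → ℂ := fun t => (lam / 2 - t) / lam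
  have hAB : ∀ t, A (B t) = t := by intro t; simp only [A, B]; field_simp; ring
  have hBA : ∀ x, B (A x) = x := by intro x; simp only [A, B]; field_simp; ring
  have hconj : ∀ k x, (logisticMap lam)^[k] x = B ((quadMap (logisticParam lam))^[k] (A x)) := by
    intro k x
    rw [← ((semiconj_logisticMap_quadMap lam).iterate_right k).eq x]
    exact (hBA _).symm
  have hper : Function.IsPeriodicPt (logisticMap lam) n (B z) := by
    change (logisticMap lam)^[n] (B z) = B z
    rw [hconj, hAB, hz.eq]
  have hA : ∀ x, HasDerivAt A (-lam) x := by
    intro x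
    simpa using ((hasDerivAt_id x).const_mul lam).const_sub (lam / 2)
  have hB : ∀ t, HasDerivAt B (-1 / lam) t := by
    intro t
    simpa using ((hasDerivAt_id t).const_sub (lam / 2)).div_const lam
  have hderiv : deriv ((logisticMap lam)^[n]) (B z) =
      deriv ((quadMap (logisticParam lam))^[n]) z := by
    have h1 : HasDerivAt ((quadMap (logisticParam lam))^[n])
        (deriv ((quadMap (logisticParam lam))^[n]) z) (A (B z)) := by
      rw [hAB]
      exact ((differentiable_quadMap _).iterate_complex n z).hasDerivAt
    have h2 := (hB _).comp (B z) (h1.comp (B z) (hA (B z)))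
    rw [show (logisticMap lam)^[n] = B ∘ (quadMap (logisticParam lam))^[n] ∘ A from
      funext (hconj n), h2.deriv]
    field_simp
  obtain ⟨r, hr, hfatou⟩ := exists_forall_mem_fatouSet (differentiable_logisticMap lam) hn hper
    (by rwa [hderiv])
  -- `B` scales distances by `1 / ‖lam‖`, hence the radius `r * ‖lam‖`.
  obtain ⟨k, hk⟩ := exists_iterate_quadMap_mem_ball hn hz hd
    (mul_pos hr (norm_pos_iff.2 hlam))
  refine hfatou (1 / 2) k ?_
  rw [hconj, show A (1 / 2) = 0 by simp only [A]; ring]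
  rw [mem_ball, dist_eq_norm] at hk ⊢
  have e : ∀ t, B t - B z = (z - t) / lam := by intro t; simp only [B]; ring
  rwa [e, norm_div, div_lt_iff₀ (norm_pos_iff.2 hlam), norm_sub_rev]

theorem isOpen_fatouSet (f : ℂ → ℂ) : IsOpen (fatouSet f) :=
  isOpen_iff_mem_nhds.2 fun _ ⟨U, hU, hz, hN⟩ =>
    mem_of_superset (hU.mem_nhds hz) fun _ hw => ⟨U, hU, hw, hN⟩

theorem deriv_logisticMap (lam x : ℂ) : deriv (logisticMap lam) x = 2 * lam * (1 / 2 - x) := by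
  have h := ((hasDerivAt_id x).const_mul lam).mul ((hasDerivAt_id x).const_sub 1)
  rw [show logisticMap lam = (fun y => lam * id y) * fun y => 1 - id y from rfl, h.deriv]
  simp only [id]
  ring

theorem mainTheorem7 (H : Set ℂ) (hH : IsHyperbolicComponent H)
    (lam : ℂ) (hlam : lam ≠ 0) (hc : logisticParam lam ∈ H) :
    (∃ δ : ℝ, 0 < δ ∧ ∀ τ ∈ juliaSet (logisticMap lam), δ < ‖deriv (logisticMap lam) τ‖) ∧
      ∀ x : ℂ, deriv (logisticMap lam) x = 0 → x ∉ juliaSet (logisticMap lam) := by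
  obtain ⟨c, -, rfl⟩ := hH
  have hhalf := half_mem_fatouSet_logisticMap hlam (connectedComponentIn_subset _ _ hc).2
  obtain ⟨r, hr, hball⟩ := Metric.isOpen_iff.1 (isOpen_fatouSet _) _ hhalf
  have hpos : 0 < ‖lam‖ := norm_pos_iff.2 hlam
  have hmain : ∀ τ ∈ juliaSet (logisticMap lam), ‖lam‖ * r < ‖deriv (logisticMap lam) τ‖ := by
    intro τ hτ
    have hle : r ≤ ‖1 / 2 - τ‖ := by
      by_contra! hlt
      exact hτ (hball (by rwa [mem_ball, dist_comm, dist_eq_norm]))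
    rw [deriv_logisticMap, norm_mul, norm_mul, Complex.norm_ofNat]
    -- The factor 2 in the derivative makes the inequality strict.
    nlinarith [mul_le_mul_of_nonneg_left hle hpos.le, mul_pos hpos hr]
  refine ⟨⟨‖lam‖ * r, mul_pos hpos hr, hmain⟩, fun x hx hxJ => ?_⟩
  have := hmain x hxJ
  rw [hx, norm_zero] at this
  exact (mul_pos hpos hr).not_gt this
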